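/- Let $d\ge 0$, $\Omega=(0,1)$ with Lebesgue measure, and $\mathbb H=L^2((0,1);\mathbb R^d)$. Let $L\in C^3(\mathbb R^d\times\mathbb R^d)$, $L=L(q,v)$, satisfy, for some constants $c_0,c_1,\lambda_0>0$: $L\ge 0$, $c_0|v|^2\le L(q,v)$ and $|\nabla_qL(q,v)|\le c_1$ for all $q,v\in\mathbb R^d$, and $$\lambda_0|v_1-v_0|^2\le\frac{d^2}{d\varepsilon^2}L\big((1-\varepsilon)q_0+\varepsilon q_1,(1-\varepsilon)v_0+\varepsilon v_1\big)\qquad\text{for all }q_0,q_1,v_0,v_1\in\mathbb R^d,\ \varepsilon\in[0,1].$$ Let $\Phi,\Psi\in C^3(\mathbb R^d)$ be even and bounded from below, with bounded first, second and third derivatives, and let $c_\Phi,c_\Psi\in\mathbb R$ be such that $c_\Phi I_d\le\nabla^2\Phi$ and $c_\Psi I_d\le\nabla^2\Psi$ everywhere. Write $c^-=\max\{-c,0\}$, and let $\|\nabla^2\Phi\|_{L^\infty}$ be the supremum of the operator norm of the Hessian (likewise for $\Psi$). Let $T>0$ satisfy $$T^2\big(c_\Phi^-+2\|\nabla^2\Phi\|_{L^\infty}\big)+T\big(c_\Psi^-+2\|\nabla^2\Psi\|_{L^\infty}\big)<\frac{\lambda_0}{2}.$$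 For $X,V\in\mathbb H$ set $$\mathcal U_*(X)=\frac12\int_{\Omega^2}\Psi(X(\omega)-X(\tilde\omega))\,d\omega\,d\tilde\omega,\qquad \hat L(X,V)=\int_\Omega L(X(\omega),V(\omega))\,d\omega+\frac12\int_{\Omega^2}\Phi(X(\omega)-X(\tilde\omega))\,d\omega\,d\tilde\omega,$$ where $\hat L$ takes values in $(-\infty,+\infty]$. Let $AC_2(0,T;\mathbb H)$ be the set of absolutely continuous curves $\gamma:[0,T]\to\mathbb H$ (which are differentiable almost everywhere) with $\int_0^T\|\dot\gamma(t)\|_{\mathbb H}^2\,dt<\infty$, and for such $\gamma$ let $$\hat{\mathcal B}_0^T(\gamma)=\int_0^T\hat L(\gamma(t),\dot\gamma(t))\,dt+\mathcal U_*(\gamma(0))\in(-\infty,+\infty].$$ Then for every $X\in\mathbb H$ the infimum $$\hat U(T,X)=\inf\big\{\hat{\mathcal B}_0^T(\gamma):\gamma\in AC_2(0,T;\mathbb H),\ \gamma(T)=X\big\}$$ is a finite real number, and there is exactly one curve $\gamma\in AC_2(0,T;\mathbb H)$ with $\gamma(T)=X$ and $\hat{\mathcal B}_0^T(\gamma)=\hat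 U(T,X)$ (uniqueness as curves on $[0,T]$). -/

import Mathlib

open MeasureTheory Set

namespace MFG

/-- `ℝ^d` with its Euclidean structure. -/
abbrev E (d : ℕ) : Type := EuclideanSpace ℝ (Fin d)

/-- Lebesgue measure on the label space `Ω = (0,1)`. -/
noncomputable abbrev labelMeasure : Measure ℝ := volume.restrict (Ioo (0 : ℝ) 1)

/-- The Hilbert space `ℍ = L²((0,1); ℝ^d)`. -/
abbrev HS (d : ℕ) : Type := Lp (E d) 2 labelMeasure

/-- The Hessian of `f` at `x`, as a bilinear form; its norm is the operator norm. -/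
noncomputable def hess {d : ℕ} (f : E d → ℝ) (x : E d) : E d →L[ℝ] E d →L[ℝ] ℝ :=
  fderiv ℝ (fderiv ℝ f) x

/-- `‖∇² f‖_{L^∞}`. It is used for `f` of class `C³` with bounded second derivative, where the
essential supremum is the supremum of a bounded function. -/
noncomputable def hessSup {d : ℕ} (f : E d → ℝ) : ℝ := ⨆ x, ‖hess f x‖

/-- The standing assumptions on the Lagrangian `L(q,v)`. -/
structure IsLagrangian {d : ℕ} (L : E d × E d → ℝ) (c₀ c₁ lam₀ : ℝ) : Prop where
  contDiff : ContDiff ℝ 3 L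
  c₀_pos : 0 < c₀
  c₁_pos : 0 < c₁
  lam₀_pos : 0 < lam₀
  nonneg : ∀ z, 0 ≤ L z
  coercive : ∀ q v, c₀ * ‖v‖ ^ 2 ≤ L (q, v)
  gradient_bound : ∀ q v, ‖gradient (fun q' => L (q', v)) q‖ ≤ c₁
  convex : ∀ q₀ q₁ v₀ v₁ : E d, ∀ ε ∈ Icc (0 : ℝ) 1,
    lam₀ * ‖v₁ - v₀‖ ^ 2 ≤
      iteratedDeriv 2
        (fun s : ℝ => L ((1 - s) • q₀ + s • q₁, (1 - s) • v₀ + s • v₁)) ε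

/-- The standing assumptions on an interaction function (`Φ` or `Ψ`), with Hessian bounded
below by `c I_d`. -/
structure IsInteraction {d : ℕ} (f : E d → ℝ) (c : ℝ) : Prop where
  contDiff : ContDiff ℝ 3 f
  even : ∀ x, f (-x) = f x
  bounded_below : ∃ m : ℝ, ∀ x, m ≤ f x
  bounded_derivs : ∀ k ∈ ({1, 2, 3} : Set ℕ), ∃ C : ℝ, ∀ x, ‖iteratedFDeriv ℝ k f x‖ ≤ C
  hess_ge : ∀ x ξ : E d, c * ‖ξ‖ ^ 2 ≤ hess f x ξ ξ

/-- The integral of an extended real valued function: the integral of the positive part minus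
the integral of the negative part. It is used for functions that are bounded below, on
finite measure spaces, so that the subtracted term is finite. -/
noncomputable def extIntegral {α : Type*} [MeasurableSpace α] (μ : Measure α) (f : α → EReal) :
    EReal :=
  ((∫⁻ a, (f a).toENNReal ∂μ : ENNReal) : EReal) - ((∫⁻ a, (-f a).toENNReal ∂μ : ENNReal) : EReal)

/-- `½ ∫_{Ω²} f (X(ω) - X(ω')) dω dω'`. -/
noncomputable def interaction {d : ℕ} (f : E d → ℝ) (X : HS d) : ℝ :=
  (1 / 2) * ∫ ω, (∫ ω', f (X ω - X ω') ∂labelMeasure) ∂labelMeasure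

/-- The running cost `L̂(X,V)`; it is `+∞` when `L(X,V)` is not integrable. -/
noncomputable def runningCost {d : ℕ} (L : E d × E d → ℝ) (Φ : E d → ℝ) (X V : HS d) : EReal :=
  extIntegral labelMeasure (fun ω => ((L (X ω, V ω) : ℝ) : EReal)) + (interaction Φ X : ℝ)

/-- `AC_2(0,T;ℍ)`: absolutely continuous curves on `[0,T]`, differentiable almost everywhere,
with square integrable derivative. Values outside `[0,T]` are irrelevant. -/
def AC2 {d : ℕ} (T : ℝ) : Set (ℝ → HS d) :=
  {γ | AbsolutelyContinuousOnInterval γ 0 T ∧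
    (∀ᵐ t ∂(volume.restrict (Ioo 0 T)), DifferentiableAt ℝ γ t) ∧
    MemLp (deriv γ) 2 (volume.restrict (Ioo 0 T))}

/-- The action `∫_0^T L̂(γ, γ̇) dt`. -/
noncomputable def action {d : ℕ} (L : E d × E d → ℝ) (Φ : E d → ℝ) (T : ℝ) (γ : ℝ → HS d) :
    EReal :=
  extIntegral (volume.restrict (Ioo 0 T)) (fun t => runningCost L Φ (γ t) (deriv γ t))

/-- The total cost `B̂(γ) = ∫_0^T L̂(γ, γ̇) dt + U_*(γ(0))`. -/
noncomputable def totalCost {d : ℕ} (L : E d × E d → ℝ) (Φ Ψ : E d → ℝ) (T : ℝ)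
    (γ : ℝ → HS d) : EReal :=
  action L Φ T γ + (interaction Ψ (γ 0) : ℝ)

/-- The value `Û(T,X)`. -/
noncomputable def value {d : ℕ} (L : E d × E d → ℝ) (Φ Ψ : E d → ℝ) (T : ℝ) (X : HS d) : EReal :=
  sInf (totalCost L Φ Ψ T '' {γ | γ ∈ AC2 T ∧ γ T = X})

end MFG

/-!
Parametrise the curves of `AC2 T` ending at `X` by their velocity: `γ(t) = X - ∫_t^T V(s) ds` with
`V ∈ L²(0,T;ℍ)`. This is a bijection onto those curves, up to their values outside `[0,T]`
(`endpointCurve_mem_AC2`, `exists_velocity_of_mem_AC2`), so the problem becomes the minimisation of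
a functional on a Hilbert space. By `totalCost_eq` that functional is the sum of the
`[0,∞]`-valued `lagrangianAction` and of the finite `interactionAction`.

The functional is uniformly midpoint convex. Along segments the second derivative of `L` is at
least `λ₀ |v₁ - v₀|²`, which survives the two integrations
(`lagrangianAction_midpoint_add_le`). The interaction energies fail to be convex by at most
`c⁻ ‖X - Y‖²`, and since all curves share the endpoint `X`, two of them satisfy
`‖γ₁(t) - γ₂(t)‖² ≤ T ‖V₁ - V₂‖²` (`norm_endpointCurve_sub_sq_le`). The defect of convexity of the
interaction part is thus controlled by `(T² c_Φ⁻ + T c_Ψ⁻) ‖V₁ - V₂‖²`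
(`interactionAction_midpoint_le`), and the smallness of `T` lets the Lagrangian part win.

The functional is also lower semicontinuous for the norm: the Lagrangian part by applying Fatou's
lemma twice (`lowerSemicontinuous_lintegral_comp`), the interaction part because it is Lipschitz.
Uniform convexity makes every minimising sequence Cauchy, so no weak compactness is needed and the
limit is the unique minimiser (`exists_unique_forall_le_of_midpoint`). The infimum is finite
because the constant curve `X` has finite cost.
-/

namespace MFG

open Filter Topology ENNReal

/-! ### Minimisation of strongly convex functionals -/

/-- A lower semicontinuous, uniformly midpoint convex functional with values in `[0, ∞]`, finite at
some point of a Banach space, has exactly one minimiser: near-minimisers are close to each other,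
so that a minimising sequence converges in norm. -/
theorem exists_unique_forall_le_of_midpoint {H : Type*} [NormedAddCommGroup H] [NormedSpace ℝ H]
    [CompleteSpace H] {G : H → ℝ≥0∞} (hlsc : LowerSemicontinuous G) {x₀ : H} (hx₀ : G x₀ ≠ ⊤)
    {c : ℝ} (hc : 0 < c)
    (hconv : ∀ x y, 2 * G ((1 / 2 : ℝ) • (x + y)) + ENNReal.ofReal (c * ‖x - y‖ ^ 2)
      ≤ G x + G y) :
    ∃ x, (∀ y, G x ≤ G y) ∧ ∀ y, G y ≤ G x → y = x := by
  set I : ℝ≥0∞ := ⨅ x, G x with hI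
  -- Two points at which `G` is within `ε` of its infimum are at squared distance `≤ 2 ε / c`.
  have hIle : ∀ x, I ≤ G x := fun x => iInf_le G x
  have hItop : I ≠ ⊤ := ne_top_of_le_ne_top hx₀ (hIle x₀)
  have key : ∀ ε : ℝ, 0 ≤ ε → ∀ x y, G x ≤ I + ENNReal.ofReal ε → G y ≤ I + ENNReal.ofReal ε →
      c * ‖x - y‖ ^ 2 ≤ 2 * ε := by
    intro ε hε x y hx hy
    have h1 : 2 * I + ENNReal.ofReal (c * ‖x - y‖ ^ 2) ≤ 2 * I + ENNReal.ofReal (2 * ε) := by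
      calc 2 * I + ENNReal.ofReal (c * ‖x - y‖ ^ 2)
          ≤ 2 * G ((1 / 2 : ℝ) • (x + y)) + ENNReal.ofReal (c * ‖x - y‖ ^ 2) := by
            gcongr; exact hIle _
        _ ≤ G x + G y := hconv x y
        _ ≤ (I + ENNReal.ofReal ε) + (I + ENNReal.ofReal ε) := add_le_add hx hy
        _ = 2 * I + ENNReal.ofReal (2 * ε) := by
            rw [ENNReal.ofReal_mul (by norm_num), ENNReal.ofReal_ofNat]; ring
    have h2 := (ENNReal.add_le_add_iff_left (by finiteness)).1 h1
    exact (ENNReal.ofReal_le_ofReal_iff (by positivity)).1 h2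
  have hex : ∀ n : ℕ, ∃ x, G x ≤ I + ENNReal.ofReal (1 / ((n : ℝ) + 1)) := by
    intro n
    have : I < I + ENNReal.ofReal (1 / ((n : ℝ) + 1)) :=
      ENNReal.lt_add_right hItop (by simp only [ne_eq, ENNReal.ofReal_eq_zero, not_le]; positivity)
    obtain ⟨x, hx⟩ := iInf_lt_iff.1 this
    exact ⟨x, hx.le⟩
  choose x hx using hex
  have hmono : ∀ N n : ℕ, N ≤ n → G (x n) ≤ I + ENNReal.ofReal (1 / ((N : ℝ) + 1)) := by
    intro N n h
    refine (hx n).trans ?_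
    gcongr
  have hb : Tendsto (fun N : ℕ => √(2 / c * (1 / ((N : ℝ) + 1)))) atTop (𝓝 0) := by
    have h := (tendsto_one_div_add_atTop_nhds_zero_nat (𝕜 := ℝ)).const_mul (2 / c)
    have h' := (Real.continuous_sqrt.tendsto _).comp h
    simpa [Function.comp_def] using h'
  have hcau : CauchySeq x := by
    refine cauchySeq_of_le_tendsto_0 _ (fun n m N hn hm => ?_) hb
    rw [dist_eq_norm]
    refine Real.le_sqrt_of_sq_le ?_
    have := key _ (by positivity) _ _ (hmono N n hn) (hmono N m hm)
    rw [div_mul_eq_mul_div, le_div_iff₀ hc]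
    linarith
  obtain ⟨z, hz⟩ := cauchySeq_tendsto_of_complete hcau
  have hzN : ∀ N : ℕ, G z ≤ I + ENNReal.ofReal (1 / ((N : ℝ) + 1)) := by
    intro N
    have hcl := hlsc.isClosed_preimage (I + ENNReal.ofReal (1 / ((N : ℝ) + 1)))
    exact hcl.mem_of_tendsto hz ((eventually_ge_atTop N).mono fun n hn => hmono N n hn)
  have hzI : G z ≤ I := by
    have h1 : Tendsto (fun N : ℕ => I + ENNReal.ofReal (1 / ((N : ℝ) + 1))) atTop (𝓝 (I + 0)) := by
      refine tendsto_const_nhds.add ?_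
      simpa using ENNReal.tendsto_ofReal (tendsto_one_div_add_atTop_nhds_zero_nat (𝕜 := ℝ))
    simpa using ge_of_tendsto' h1 hzN
  refine ⟨z, fun y => hzI.trans (hIle y), fun y hy => ?_⟩
  have h := key 0 le_rfl y z (by simpa using hy.trans hzI) (by simpa using hzI)
  have h0 : ‖y - z‖ ^ 2 ≤ 0 := by
    by_contra! hcon
    nlinarith [mul_pos hc hcon]
  have : ‖y - z‖ = 0 := by nlinarith [norm_nonneg (y - z)]
  exact sub_eq_zero.1 (norm_eq_zero.1 this)

/-- Quantitative midpoint convexity: `g s - c s² / 2` is convex on `[0,1]`. -/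
theorem midpoint_add_le_of_le_iteratedDeriv_two {g : ℝ → ℝ} (hg : ContDiff ℝ 2 g) {c : ℝ}
    (h : ∀ s ∈ Icc (0 : ℝ) 1, c ≤ iteratedDeriv 2 g s) :
    2 * g (1 / 2) + c / 4 ≤ g 0 + g 1 := by
  have hd : Differentiable ℝ g := hg.differentiable (by norm_num)
  have hd2 : Differentiable ℝ (deriv g) := by
    have := hg.differentiable_iteratedDeriv 1 (by norm_num)
    simpa [iteratedDeriv_one] using this
  have hq : ∀ s : ℝ, HasDerivAt (fun s : ℝ => g s - c / 2 * s ^ 2) (deriv g s - c * s) s := by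
    intro s
    have := (hd s).hasDerivAt.sub (((hasDerivAt_pow 2 s)).const_mul (c / 2))
    refine this.congr_deriv ?_
    norm_num; ring
  have hq1 : deriv (fun s : ℝ => g s - c / 2 * s ^ 2) = fun s => deriv g s - c * s :=
    funext fun s => (hq s).deriv
  have hq2 : ∀ s : ℝ, HasDerivAt (fun s : ℝ => deriv g s - c * s) (iteratedDeriv 2 g s - c) s := by
    intro s
    have h1 : HasDerivAt (deriv g) (iteratedDeriv 2 g s) s := by
      have := (hd2 s).hasDerivAt
      rwa [iteratedDeriv_succ, iteratedDeriv_one]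
    exact (h1.sub ((hasDerivAt_id s).const_mul c)).congr_deriv (by simp)
  have hconv : ConvexOn ℝ (Icc (0 : ℝ) 1) (fun s : ℝ => g s - c / 2 * s ^ 2) := by
    refine convexOn_of_deriv2_nonneg' (convex_Icc 0 1)
      (fun s _ => (hq s).differentiableAt.differentiableWithinAt) ?_ ?_
    · rw [hq1]; exact fun s _ => (hq2 s).differentiableAt.differentiableWithinAt
    · intro s hs
      simp only [Function.iterate_succ, Function.iterate_zero, Function.comp_apply, id_eq]
      rw [hq1, (hq2 s).deriv]
      linarith [h s hs]
  have hmid := (convexOn_iff_forall_pos.1 hconv).2 (left_mem_Icc.2 zero_le_one)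
    (right_mem_Icc.2 zero_le_one) one_half_pos one_half_pos (add_halves 1)
  norm_num at hmid ⊢
  linarith

/-! ### Integral functionals -/

theorem extIntegral_congr_ae {α : Type*} [MeasurableSpace α] {μ : Measure α} {f g : α → EReal}
    (h : f =ᵐ[μ] g) : extIntegral μ f = extIntegral μ g := by
  have h1 : ∫⁻ a, (f a).toENNReal ∂μ = ∫⁻ a, (g a).toENNReal ∂μ :=
    lintegral_congr_ae (h.fun_comp EReal.toENNReal)
  have h2 : ∫⁻ a, (-f a).toENNReal ∂μ = ∫⁻ a, (-g a).toENNReal ∂μ :=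
    lintegral_congr_ae (h.fun_comp fun x => (-x).toENNReal)
  rw [extIntegral, extIntegral, h1, h2]

/-- The extended integral is additive on the sum of a `[0, ∞]`-valued function and of an integrable
real one; its negative part is then dominated by that of the integrable summand. -/
theorem extIntegral_coe_add {α : Type*} [MeasurableSpace α] {μ : Measure α} {a : α → ℝ≥0∞}
    {r : α → ℝ} (ha : AEMeasurable a μ) (hr : Integrable r μ) :
    extIntegral μ (fun t => (a t : EReal) + (r t : EReal))
      = ((∫⁻ t, a t ∂μ : ℝ≥0∞) : EReal) + ((∫ t, r t ∂μ : ℝ) : EReal) := by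
  have hrm := hr.aestronglyMeasurable.aemeasurable
  have hfm : AEMeasurable (fun t => (a t : EReal) + (r t : EReal)) μ :=
    ha.coe_ereal_ennreal.add hrm.coe_real_ereal
  have hn : AEMeasurable (fun t => (-((a t : EReal) + (r t : EReal))).toENNReal) μ :=
    hfm.neg.ereal_toENNReal
  have hp : AEMeasurable (fun t => ((a t : EReal) + (r t : EReal)).toENNReal) μ :=
    hfm.ereal_toENNReal
  -- With `s = a + r`, integrate `s⁺ + r⁻ = s⁻ + (a + r⁺)`, in which nothing is subtracted.
  have hpt : ∀ (x : ℝ≥0∞) (y : ℝ), ((x : EReal) + (y : EReal)).toENNReal + ENNReal.ofReal (-y)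
      = (-((x : EReal) + (y : EReal))).toENNReal + (x + ENNReal.ofReal y) := by
    intro x y
    induction x with
    | top => simp
    | coe x =>
      have e : ((x : ℝ≥0∞) : EReal) + (y : EReal) = (((x : ℝ) + y : ℝ) : EReal) := rfl
      rw [e, ← EReal.coe_neg, EReal.toENNReal_of_ne_top (EReal.coe_ne_top _),
        EReal.toENNReal_of_ne_top (EReal.coe_ne_top _), EReal.toReal_coe, EReal.toReal_coe,
        ← ENNReal.ofReal_coe_nnreal]
      have hx : (0 : ℝ) ≤ x := x.2
      rcases le_total 0 y with hy | hy
      · rw [ENNReal.ofReal_of_nonpos (p := -y) (by linarith),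
          ENNReal.ofReal_of_nonpos (p := -((x : ℝ) + y)) (by linarith), add_zero, zero_add,
          ENNReal.ofReal_add hx hy]
      · rw [ENNReal.ofReal_of_nonpos hy, add_zero]
        rcases le_total 0 ((x : ℝ) + y) with h | h
        · rw [ENNReal.ofReal_of_nonpos (p := -((x : ℝ) + y)) (by linarith),
            ← ENNReal.ofReal_add h (by linarith), zero_add]
          congr 1; ring
        · rw [ENNReal.ofReal_of_nonpos h, ← ENNReal.ofReal_add (by linarith) hx, zero_add]
          congr 1; ring
  have hnle : ∀ t, (-((a t : EReal) + (r t : EReal))).toENNReal ≤ ENNReal.ofReal (-r t) := by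
    intro t
    have : -((a t : EReal) + (r t : EReal)) ≤ ((-r t : ℝ) : EReal) := by
      rw [EReal.coe_neg, EReal.neg_le_neg_iff]
      exact le_add_of_nonneg_left (EReal.coe_ennreal_nonneg _)
    have h2 := EReal.toENNReal_le_toENNReal this
    rwa [EReal.toENNReal_of_ne_top (EReal.coe_ne_top _), EReal.toReal_coe] at h2
  have hrp : ∫⁻ t, ENNReal.ofReal (r t) ∂μ ≠ ⊤ := hr.lintegral_lt_top.ne
  have hrn : ∫⁻ t, ENNReal.ofReal (-r t) ∂μ ≠ ⊤ := hr.neg.lintegral_lt_top.ne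
  have hnt : ∫⁻ t, (-((a t : EReal) + (r t : EReal))).toENNReal ∂μ ≠ ⊤ :=
    ne_top_of_le_ne_top hrn (lintegral_mono hnle)
  have hint : ∫⁻ t, ((a t : EReal) + (r t : EReal)).toENNReal ∂μ + ∫⁻ t, ENNReal.ofReal (-r t) ∂μ
      = ∫⁻ t, (-((a t : EReal) + (r t : EReal))).toENNReal ∂μ
        + (∫⁻ t, a t ∂μ + ∫⁻ t, ENNReal.ofReal (r t) ∂μ) := by
    rw [← lintegral_add_left' hp, ← lintegral_add_left' ha, ← lintegral_add_left' hn]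
    exact lintegral_congr fun t => hpt _ _
  rw [extIntegral, integral_eq_lintegral_pos_part_sub_lintegral_neg_part hr]
  generalize ∫⁻ t, ((a t : EReal) + (r t : EReal)).toENNReal ∂μ = P at *
  generalize ∫⁻ t, (-((a t : EReal) + (r t : EReal))).toENNReal ∂μ = N at *
  generalize ∫⁻ t, ENNReal.ofReal (-r t) ∂μ = Rn at *
  generalize ∫⁻ t, ENNReal.ofReal (r t) ∂μ = Rp at *
  generalize ∫⁻ t, a t ∂μ = A at *
  lift N to NNReal using hnt
  lift Rn to NNReal using hrn
  lift Rp to NNReal using hrp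
  induction A with
  | top =>
    have : P = ⊤ := by simpa using hint
    subst this
    simp only [EReal.coe_ennreal_top]
    rfl
  | coe A =>
    have hPt : P ≠ ⊤ := by
      intro h; subst h
      simp only [top_add] at hint
      exact absurd hint.symm (by finiteness)
    lift P to NNReal using hPt
    have h' : (P : ℝ) + Rn = N + (A + Rp) := by exact_mod_cast hint
    change ((P : ℝ) : EReal) - ((N : ℝ) : EReal)
      = ((A : ℝ) : EReal) + (((Rp : ℝ) - (Rn : ℝ) : ℝ) : EReal)
    rw [← EReal.coe_sub, ← EReal.coe_add]
    congr 1
    linarith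

/-- Lower semicontinuity of an integral functional with lower semicontinuous integrand, by Fatou's
lemma. Convergence of the parameters is only assumed to give convergence almost everywhere along a
subsequence, which is what convergence in `L²` provides. -/
theorem lowerSemicontinuous_lintegral_comp {α M Y : Type*} [MeasurableSpace α] {μ : Measure α}
    [PseudoMetricSpace M] [TopologicalSpace Y] {F : M → α → Y} {g : Y → ℝ≥0∞}
    (hg : LowerSemicontinuous g) (hmeas : ∀ u, AEMeasurable (fun a => g (F u a)) μ)
    (hF : ∀ (u : ℕ → M) (v : M), Tendsto u atTop (𝓝 v) → ∃ ns : ℕ → ℕ, StrictMono ns ∧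
      ∀ᵐ a ∂μ, Tendsto (fun k => F (u (ns k)) a) atTop (𝓝 (F v a))) :
    LowerSemicontinuous fun u => ∫⁻ a, g (F u a) ∂μ := by
  rw [lowerSemicontinuous_iff_isClosed_preimage]
  intro y
  refine IsSeqClosed.isClosed fun u v hu huv => ?_
  obtain ⟨ns, -, hns⟩ := hF u v huv
  calc ∫⁻ a, g (F v a) ∂μ
      ≤ ∫⁻ a, liminf (fun k => g (F (u (ns k)) a)) atTop ∂μ := by
        refine lintegral_mono_ae (hns.mono fun a ha => ?_)
        exact (lowerSemicontinuousAt_iff_le_liminf.1 (hg (F v a))).trans ha.liminf_le_liminf_comp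
    _ ≤ liminf (fun k => ∫⁻ a, g (F (u (ns k)) a) ∂μ) atTop :=
        lintegral_liminf_le' fun k => hmeas _
    _ ≤ liminf (fun _ : ℕ => y) atTop := liminf_le_liminf (Eventually.of_forall fun k => hu (ns k))
    _ = y := by simp

theorem aemeasurable_comp_of_lowerSemicontinuous {α Y : Type*} [MeasurableSpace α]
    {μ : Measure α} [TopologicalSpace Y] [TopologicalSpace.PseudoMetrizableSpace Y] {f : α → Y}
    {g : Y → ℝ≥0∞} (hg : LowerSemicontinuous g) (hf : AEStronglyMeasurable f μ) :
    AEMeasurable (fun a => g (f a)) μ := by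
  borelize Y
  exact hg.measurable.comp_aemeasurable hf.aemeasurable

theorem integral_norm_sq_eq_norm_sq {α F : Type*} [MeasurableSpace α] {μ : Measure α}
    [NormedAddCommGroup F] [InnerProductSpace ℝ F] (f : Lp F 2 μ) :
    ∫ a, ‖f a‖ ^ 2 ∂μ = ‖f‖ ^ 2 := by
  rw [← real_inner_self_eq_norm_sq, L2.inner_def]
  simp only [real_inner_self_eq_norm_sq]

theorem integrable_norm_sq {α F : Type*} [MeasurableSpace α] {μ : Measure α}
    [NormedAddCommGroup F] (f : Lp F 2 μ) : Integrable (fun a => ‖f a‖ ^ 2) μ :=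
  (memLp_two_iff_integrable_sq_norm (Lp.aestronglyMeasurable f)).1 (Lp.memLp f)

/-- The Cauchy–Schwarz inequality against the constant function `1`. -/
theorem sq_integral_norm_le {α F : Type*} [MeasurableSpace α] {μ : Measure α} [IsFiniteMeasure μ]
    [NormedAddCommGroup F] [InnerProductSpace ℝ F] (f : Lp F 2 μ) :
    (∫ a, ‖f a‖ ∂μ) ^ 2 ≤ μ.real univ * ‖f‖ ^ 2 := by
  have hf2 := integrable_norm_sq f
  have hf1 : Integrable (fun a => ‖f a‖) μ := ((Lp.memLp f).integrable one_le_two).norm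
  set m := μ.real univ with hm
  set I := ∫ a, ‖f a‖ ∂μ with hI
  -- The square has integral `m (m ‖f‖² - I²)`, where `‖f‖` is the `L²` norm.
  have h0 : 0 ≤ ∫ a, (m * ‖f a‖ - I) ^ 2 ∂μ := integral_nonneg fun a => sq_nonneg _
  have h1 : ∫ a, (m * ‖f a‖ - I) ^ 2 ∂μ = m ^ 2 * ‖f‖ ^ 2 - 2 * m * I * I + m * I ^ 2 := by
    have e : (fun a => (m * ‖f a‖ - I) ^ 2)
        = fun a => m ^ 2 * ‖f a‖ ^ 2 - (2 * m * I) * ‖f a‖ + I ^ 2 := by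
      funext a; ring
    rw [e, integral_add (f := fun a => m ^ 2 * ‖f a‖ ^ 2 - (2 * m * I) * ‖f a‖)
        ((hf2.const_mul _).sub (hf1.const_mul _)) (integrable_const _),
      integral_sub (hf2.const_mul _) (hf1.const_mul _), integral_const_mul, integral_const_mul,
      integral_norm_sq_eq_norm_sq, integral_const, smul_eq_mul]
  have hm0 : 0 ≤ m := measureReal_nonneg
  rcases hm0.eq_or_lt with h | h
  · have : μ = 0 := by
      rw [← Measure.measure_univ_eq_zero]
      exact (measureReal_eq_zero_iff).1 h.symm
    have hI0 : I = 0 := by subst this; simp [hI]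
    rw [hI0, ← h]; simp
  · have h3 : 0 ≤ m * (m * ‖f‖ ^ 2 - I ^ 2) := by rw [h1] at h0; linarith
    have := nonneg_of_mul_nonneg_right h3 h
    linarith

/-- Integration of a pointwise midpoint convexity inequality whose gain is quadratic. Applied over
the label space and again over time. -/
theorem lintegral_midpoint_add_le {α F : Type*} [MeasurableSpace α] {μ : Measure α}
    [NormedAddCommGroup F] [InnerProductSpace ℝ F] {c : ℝ} (hc : 0 ≤ c) (U V : Lp F 2 μ)
    {a b₀ b₁ : α → ℝ≥0∞} (ha : AEMeasurable a μ) (hb : AEMeasurable b₀ μ)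
    (h : ∀ᵐ t ∂μ, 2 * a t + ENNReal.ofReal (c * ‖U t - V t‖ ^ 2) ≤ b₀ t + b₁ t) :
    2 * ∫⁻ t, a t ∂μ + ENNReal.ofReal (c * ‖U - V‖ ^ 2) ≤ ∫⁻ t, b₀ t ∂μ + ∫⁻ t, b₁ t ∂μ := by
  have e : ENNReal.ofReal (c * ‖U - V‖ ^ 2)
      = ∫⁻ t, ENNReal.ofReal (c * ‖U t - V t‖ ^ 2) ∂μ := by
    rw [← integral_norm_sq_eq_norm_sq, ← integral_const_mul,
      ofReal_integral_eq_lintegral_ofReal ((integrable_norm_sq _).const_mul c)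
        (Eventually.of_forall fun t => by positivity)]
    refine lintegral_congr_ae ((Lp.coeFn_sub U V).mono fun t ht => ?_)
    simp only [ht, Pi.sub_apply]
  rw [e, ← lintegral_const_mul'' _ ha, ← lintegral_add_left' (ha.const_mul 2),
    ← lintegral_add_left' hb]
  exact lintegral_mono_ae h

/-! ### Absolutely continuous curves with values in a Banach space -/

theorem absolutelyContinuousOnInterval_of_dist_le {Y Z : Type*} [PseudoMetricSpace Y]
    [PseudoMetricSpace Z] {f : ℝ → Y} {g : ℝ → Z} {a b : ℝ}
    (hg : AbsolutelyContinuousOnInterval g a b)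
    (h : ∀ x ∈ uIcc a b, ∀ y ∈ uIcc a b, dist (f x) (f y) ≤ dist (g x) (g y)) :
    AbsolutelyContinuousOnInterval f a b := by
  rw [absolutelyContinuousOnInterval_iff] at hg ⊢
  intro ε hε
  obtain ⟨δ, hδ, H⟩ := hg ε hε
  refine ⟨δ, hδ, fun P hP hlt => (Finset.sum_le_sum fun i hi => ?_).trans_lt (H P hP hlt)⟩
  exact h _ (hP.1 i hi).1 _ (hP.1 i hi).2

/-- A Bochner primitive moves by at most as much as the primitive of the norm, which reduces its
absolute continuity to the real case. -/
theorem absolutelyContinuousOnInterval_integral {F : Type*} [NormedAddCommGroup F]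
    [NormedSpace ℝ F] {f : ℝ → F} {a b c : ℝ} (hf : IntervalIntegrable f volume a b)
    (hc : c ∈ uIcc a b) : AbsolutelyContinuousOnInterval (fun x => ∫ v in c..x, f v) a b := by
  refine absolutelyContinuousOnInterval_of_dist_le
    (hf.norm.absolutelyContinuousOnInterval_intervalIntegral hc) fun x hx y hy => ?_
  have hi : ∀ x ∈ uIcc a b, ∀ y ∈ uIcc a b, IntervalIntegrable f volume x y := fun x hx y hy =>
    hf.mono_set (uIcc_subset_uIcc hx hy)
  rw [dist_comm, dist_comm (∫ v in c..x, ‖f v‖), dist_eq_norm, Real.dist_eq,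
    intervalIntegral.integral_interval_sub_left (hi _ hc _ hy) (hi _ hc _ hx),
    intervalIntegral.integral_interval_sub_left (hi _ hc _ hy).norm (hi _ hc _ hx).norm]
  exact intervalIntegral.norm_integral_le_abs_integral_norm

/-- The fundamental theorem of calculus for absolutely continuous functions with values in a Banach
space. Without the Radon–Nikodym property almost everywhere differentiability is not automatic, and
it is a hypothesis. -/
theorem sub_eq_integral_of_ae_hasDerivAt {F : Type*} [NormedAddCommGroup F]
    [NormedSpace ℝ F] [CompleteSpace F] {f f' : ℝ → F} {a b : ℝ}
    (hf : AbsolutelyContinuousOnInterval f a b) (hf' : IntervalIntegrable f' volume a b)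
    (h : ∀ᵐ t, t ∈ uIcc a b → HasDerivAt f (f' t) t) {x : ℝ} (hx : x ∈ uIcc a b) :
    f x - f b = ∫ t in b..x, f' t := by
  have hb : b ∈ uIcc a b := right_mem_uIcc
  obtain ⟨C, hC⟩ := AbsolutelyContinuousOnInterval.const_of_ae_hasDerivAt_zero
    (hf.sub (absolutelyContinuousOnInterval_integral hf' hb)) (by
      filter_upwards [h, hf'.ae_hasDerivAt_integral] with t h1 h2 ht
      simpa using (h1 ht).sub (h2 ht b hb))
  have e1 := hC x hx
  have e2 := hC b hb
  simp only [Pi.sub_apply, intervalIntegral.integral_same, sub_zero] at e1 e2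
  rw [e2, ← e1]; abel

variable {d : ℕ}

/-! ### The Lagrangian cost -/

/-- `∫_Ω L(X(ω), V(ω)) dω` with values in `[0, ∞]`, for a nonnegative Lagrangian `L`. -/
noncomputable def lagrangianCost (L : E d × E d → ℝ) (p : HS d × HS d) : ℝ≥0∞ :=
  ∫⁻ ω, ENNReal.ofReal (L (p.1 ω, p.2 ω)) ∂labelMeasure

/-- The splitting holds also where `L(X,V)` is not integrable: both sides are then `⊤`. -/
theorem runningCost_eq {L : E d × E d → ℝ} (hL : ∀ z, 0 ≤ L z) (Φ : E d → ℝ) (X V : HS d) :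
    runningCost L Φ X V = (lagrangianCost L (X, V) : EReal) + (interaction Φ X : ℝ) := by
  have h1 : ∀ z, ((L z : ℝ) : EReal).toENNReal = ENNReal.ofReal (L z) := fun z => rfl
  have h2 : ∀ z, (-((L z : ℝ) : EReal)).toENNReal = 0 := fun z =>
    EReal.toENNReal_of_nonpos (by
      rw [← EReal.coe_neg]; exact_mod_cast neg_nonpos.2 (hL z))
  simp only [runningCost, extIntegral, h1, h2, lintegral_zero, EReal.coe_ennreal_zero, sub_zero]
  rfl

theorem aestronglyMeasurable_comp_Lp {L : E d × E d → ℝ} (hL : Continuous L) (X V : HS d) :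
    AEStronglyMeasurable (fun ω => L (X ω, V ω)) labelMeasure :=
  hL.comp_aestronglyMeasurable
    ((Lp.aestronglyMeasurable X).prodMk (Lp.aestronglyMeasurable V))

theorem exists_subseq_ae_tendsto_of_tendsto_Lp {α F : Type*} [MeasurableSpace α] {μ : Measure α}
    [NormedAddCommGroup F] {u : ℕ → Lp F 2 μ} {v : Lp F 2 μ} (h : Tendsto u atTop (𝓝 v)) :
    ∃ ns : ℕ → ℕ, StrictMono ns ∧
      ∀ᵐ a ∂μ, Tendsto (fun k => u (ns k) a) atTop (𝓝 (v a)) :=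
  (tendstoInMeasure_of_tendsto_Lp h).exists_seq_tendsto_ae

theorem lowerSemicontinuous_lagrangianCost {L : E d × E d → ℝ} (hL : Continuous L) :
    LowerSemicontinuous (lagrangianCost L) := by
  refine lowerSemicontinuous_lintegral_comp (F := fun (p : HS d × HS d) ω => (p.1 ω, p.2 ω))
    (g := fun z => ENNReal.ofReal (L z)) (ENNReal.continuous_ofReal.comp hL).lowerSemicontinuous
    (fun p => (aestronglyMeasurable_comp_Lp hL p.1 p.2).aemeasurable.ennreal_ofReal) ?_
  intro u v huv
  obtain ⟨ns, hns, h1⟩ := exists_subseq_ae_tendsto_of_tendsto_Lp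
    ((continuous_fst.tendsto v).comp huv)
  obtain ⟨ms, hms, h2⟩ := exists_subseq_ae_tendsto_of_tendsto_Lp
    (((continuous_snd.tendsto v).comp huv).comp hns.tendsto_atTop)
  refine ⟨ns ∘ ms, hns.comp hms, ?_⟩
  filter_upwards [h1, h2] with ω a1 a2
  exact (a1.comp hms.tendsto_atTop).prodMk_nhds a2

namespace IsLagrangian

variable {L : E d × E d → ℝ} {c₀ c₁ lam₀ : ℝ}

theorem midpoint_add_le (hL : IsLagrangian L c₀ c₁ lam₀) (q₀ q₁ v₀ v₁ : E d) :
    2 * L ((1 / 2 : ℝ) • (q₀ + q₁), (1 / 2 : ℝ) • (v₀ + v₁)) + lam₀ / 4 * ‖v₀ - v₁‖ ^ 2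
      ≤ L (q₀, v₀) + L (q₁, v₁) := by
  have hg : ContDiff ℝ 2
      (fun s : ℝ => L ((1 - s) • q₀ + s • q₁, (1 - s) • v₀ + s • v₁)) :=
    (hL.contDiff.of_le (by norm_num)).comp (by fun_prop)
  have h := midpoint_add_le_of_le_iteratedDeriv_two hg (hL.convex q₀ q₁ v₀ v₁)
  rw [norm_sub_rev v₁ v₀] at h
  have e : (1 - 1 / 2 : ℝ) = 1 / 2 := by norm_num
  simp only [e, ← smul_add, sub_zero, one_smul, zero_smul, add_zero, sub_self, zero_add] at h
  linarith

theorem lagrangianCost_midpoint_add_le (hL : IsLagrangian L c₀ c₁ lam₀) (X Y U V : HS d) :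
    2 * lagrangianCost L ((1 / 2 : ℝ) • (X + Y), (1 / 2 : ℝ) • (U + V))
        + ENNReal.ofReal (lam₀ / 4 * ‖U - V‖ ^ 2)
      ≤ lagrangianCost L (X, U) + lagrangianCost L (Y, V) := by
  have hc := hL.contDiff.continuous
  refine lintegral_midpoint_add_le (by linarith [hL.lam₀_pos]) U V
    (aestronglyMeasurable_comp_Lp hc _ _).aemeasurable.ennreal_ofReal
    (aestronglyMeasurable_comp_Lp hc _ _).aemeasurable.ennreal_ofReal ?_
  filter_upwards [Lp.coeFn_smul (1 / 2 : ℝ) (X + Y), Lp.coeFn_smul (1 / 2 : ℝ) (U + V),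
    Lp.coeFn_add X Y, Lp.coeFn_add U V] with ω h1 h2 h3 h4
  simp only [h1, h2, h3, h4, Pi.smul_apply, Pi.add_apply]
  have hl := hL.lam₀_pos
  rw [two_mul, ← ENNReal.ofReal_add (hL.nonneg _) (hL.nonneg _),
    ← ENNReal.ofReal_add (add_nonneg (hL.nonneg _) (hL.nonneg _)) (by positivity),
    ← ENNReal.ofReal_add (hL.nonneg _) (hL.nonneg _), ← two_mul]
  exact ENNReal.ofReal_le_ofReal (hL.midpoint_add_le _ _ _ _)

theorem lagrangianCost_zero_lt_top (hL : IsLagrangian L c₀ c₁ lam₀) (X : HS d) :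
    lagrangianCost L (X, 0) < ⊤ := by
  have hdiff : Differentiable ℝ fun q : E d => L (q, 0) :=
    (hL.contDiff.differentiable (by norm_num)).comp (by fun_prop)
  have hgrow : ∀ q : E d, L (q, 0) ≤ L (0, 0) + c₁ * ‖q‖ := by
    intro q
    have h := Convex.norm_image_sub_le_of_norm_fderiv_le (𝕜 := ℝ) (C := c₁)
      (f := fun q : E d => L (q, 0)) (s := univ) (x := 0) (y := q) (fun x _ => hdiff x)
      (fun x _ => by
        have := hL.gradient_bound x 0
        rwa [gradient, LinearIsometryEquiv.norm_map] at this)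
      convex_univ (mem_univ _) (mem_univ _)
    rw [sub_zero] at h
    linarith [le_abs_self (L (q, 0) - L (0, 0)), Real.norm_eq_abs (L (q, 0) - L (0, 0))]
  have hX : Integrable (fun ω => L (0, 0) + c₁ * ‖X ω‖) labelMeasure :=
    (integrable_const _).add (((Lp.memLp X).integrable one_le_two).norm.const_mul _)
  refine lt_of_le_of_lt (lintegral_mono_ae ?_) hX.lintegral_lt_top
  filter_upwards [Lp.coeFn_zero (E d) 2 labelMeasure] with ω hω
  simp only [hω, Pi.zero_apply]
  exact ENNReal.ofReal_le_ofReal (hgrow _)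

end IsLagrangian

/-! ### The interaction energy -/

theorem integrable_norm_coe (X : HS d) : Integrable (fun ω => ‖X ω‖) labelMeasure :=
  ((Lp.memLp X).integrable one_le_two).norm

instance isProbabilityMeasure_labelMeasure : IsProbabilityMeasure labelMeasure := ⟨by simp⟩

theorem integral_norm_le_norm (X : HS d) : ∫ ω, ‖X ω‖ ∂labelMeasure ≤ ‖X‖ := by
  have h := sq_integral_norm_le X
  rw [probReal_univ, one_mul] at h
  exact le_of_sq_le_sq h (norm_nonneg X)

/-- A Lipschitz `f` grows at most linearly, so the double integral in `interaction f X` converges. -/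
theorem integrable_interaction {f : E d → ℝ} {C : NNReal} (hf : LipschitzWith C f) (X : HS d) :
    Integrable (fun z : ℝ × ℝ => f (X z.1 - X z.2)) (labelMeasure.prod labelMeasure) := by
  have h1 : Integrable (fun z : ℝ × ℝ => X z.1 - X z.2) (labelMeasure.prod labelMeasure) :=
    (((Lp.memLp X).integrable one_le_two).comp_fst _).sub
      (((Lp.memLp X).integrable one_le_two).comp_snd _)
  refine ((integrable_const |f 0|).add (h1.norm.const_mul C)).mono'
    (hf.continuous.comp_aestronglyMeasurable h1.aestronglyMeasurable)
    (Eventually.of_forall fun z => ?_)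
  have h := hf.dist_le_mul (X z.1 - X z.2) 0
  rw [dist_zero_right, Real.dist_eq] at h
  have h3 := abs_sub_abs_le_abs_sub (f (X z.1 - X z.2)) (f 0)
  simp only [Pi.add_apply, Real.norm_eq_abs]
  linarith

theorem interaction_eq_integral_prod {f : E d → ℝ} {C : NNReal} (hf : LipschitzWith C f)
    (X : HS d) : interaction f X
      = (1 / 2) * ∫ z, f (X z.1 - X z.2) ∂(labelMeasure.prod labelMeasure) := by
  rw [interaction, integral_prod _ (integrable_interaction hf X)]

theorem ae_prod_of_ae {p : ℝ → Prop} (h : ∀ᵐ ω ∂labelMeasure, p ω) :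
    ∀ᵐ z ∂(labelMeasure.prod labelMeasure), p z.1 ∧ p z.2 :=
  (Measure.quasiMeasurePreserving_fst.ae h).and (Measure.quasiMeasurePreserving_snd.ae h)

theorem abs_interaction_sub_le {f : E d → ℝ} {C : NNReal} (hf : LipschitzWith C f)
    (X Y : HS d) : |interaction f X - interaction f Y| ≤ C * ‖X - Y‖ := by
  have hi := integrable_norm_coe (X - Y)
  have key : |∫ z, f (X z.1 - X z.2) ∂(labelMeasure.prod labelMeasure)
      - ∫ z, f (Y z.1 - Y z.2) ∂(labelMeasure.prod labelMeasure)|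
      ≤ ∫ z, C * (‖(X - Y) z.1‖ + ‖(X - Y) z.2‖) ∂(labelMeasure.prod labelMeasure) := by
    rw [← integral_sub (integrable_interaction hf X) (integrable_interaction hf Y),
      ← Real.norm_eq_abs]
    refine norm_integral_le_of_norm_le (((hi.comp_fst _).add (hi.comp_snd _)).const_mul _) ?_
    filter_upwards [ae_prod_of_ae (Lp.coeFn_sub X Y)] with z hz
    rw [hz.1, hz.2, ← dist_eq_norm]
    refine (hf.dist_le_mul _ _).trans ?_
    gcongr
    rw [dist_eq_norm, Pi.sub_apply, Pi.sub_apply]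
    refine le_trans (le_of_eq ?_) (norm_sub_le _ _)
    congr 1; abel
  have e : ∫ z, (C : ℝ) * (‖(X - Y) z.1‖ + ‖(X - Y) z.2‖) ∂(labelMeasure.prod labelMeasure)
      = C * (2 * ∫ ω, ‖(X - Y) ω‖ ∂labelMeasure) := by
    rw [integral_const_mul, integral_add (hi.comp_fst _) (hi.comp_snd _),
      integral_fun_fst (fun ω => ‖(X - Y) ω‖), integral_fun_snd (fun ω => ‖(X - Y) ω‖)]
    simp only [probReal_univ, one_smul]
    ring
  rw [interaction_eq_integral_prod hf, interaction_eq_integral_prod hf, ← mul_sub, abs_mul,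
    abs_of_pos (by norm_num : (0 : ℝ) < 1 / 2)]
  have h2 : (C : ℝ) * ∫ ω, ‖(X - Y) ω‖ ∂labelMeasure ≤ C * ‖X - Y‖ :=
    mul_le_mul_of_nonneg_left (integral_norm_le_norm (X - Y)) C.2
  linarith

theorem continuous_interaction {f : E d → ℝ} {C : NNReal} (hf : LipschitzWith C f) :
    Continuous (interaction f : HS d → ℝ) :=
  (LipschitzWith.of_dist_le_mul fun X Y => by
    rw [Real.dist_eq, dist_eq_norm]; exact abs_interaction_sub_le hf X Y).continuous

theorem le_interaction {f : E d → ℝ} {C : NNReal} (hf : LipschitzWith C f) {m : ℝ}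
    (hm : ∀ x, m ≤ f x) (X : HS d) : m / 2 ≤ interaction f X := by
  rw [interaction_eq_integral_prod hf]
  have : ∫ _z, m ∂((labelMeasure).prod labelMeasure)
      ≤ ∫ z, f (X z.1 - X z.2) ∂(labelMeasure.prod labelMeasure) :=
    integral_mono (integrable_const _) (integrable_interaction hf X) fun z => hm _
  rw [integral_const, probReal_univ, one_smul] at this
  linarith

/-- Midpoint semiconvexity passes from `f` to its interaction energy; the constant comes from
`|a - b|² ≤ 2 |a|² + 2 |b|²`. -/
theorem interaction_midpoint_le {f : E d → ℝ} {C : NNReal} (hf : LipschitzWith C f) {k : ℝ}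
    (hk : 0 ≤ k)
    (hmid : ∀ x y : E d, 2 * f ((1 / 2 : ℝ) • (x + y)) ≤ f x + f y + k / 4 * ‖x - y‖ ^ 2)
    (X Y : HS d) :
    2 * interaction f ((1 / 2 : ℝ) • (X + Y))
      ≤ interaction f X + interaction f Y + k / 2 * ‖X - Y‖ ^ 2 := by
  have hi := integrable_norm_sq (X - Y)
  have hle : 2 * ∫ z, f (((1 / 2 : ℝ) • (X + Y) : HS d) z.1 - ((1 / 2 : ℝ) • (X + Y) : HS d) z.2)
        ∂(labelMeasure.prod labelMeasure)
      ≤ ∫ z, f (X z.1 - X z.2) ∂(labelMeasure.prod labelMeasure)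
        + ∫ z, f (Y z.1 - Y z.2) ∂(labelMeasure.prod labelMeasure)
        + k / 2 * (2 * ∫ ω, ‖(X - Y) ω‖ ^ 2 ∂labelMeasure) := by
    have e : 2 * ∫ ω, ‖(X - Y) ω‖ ^ 2 ∂labelMeasure
        = ∫ z, (‖(X - Y) z.1‖ ^ 2 + ‖(X - Y) z.2‖ ^ 2) ∂(labelMeasure.prod labelMeasure) := by
      rw [integral_add (hi.comp_fst _) (hi.comp_snd _),
        integral_fun_fst (fun ω => ‖(X - Y) ω‖ ^ 2), integral_fun_snd (fun ω => ‖(X - Y) ω‖ ^ 2)]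
      simp only [probReal_univ, one_smul]
      ring
    have i1 := integrable_interaction hf X
    have i2 := integrable_interaction hf Y
    have i3 : Integrable (fun z : ℝ × ℝ => k / 2 * (‖(X - Y) z.1‖ ^ 2 + ‖(X - Y) z.2‖ ^ 2))
        (labelMeasure.prod labelMeasure) := ((hi.comp_fst _).add (hi.comp_snd _)).const_mul _
    rw [e, ← integral_const_mul, ← integral_const_mul, ← integral_add i1 i2,
      ← integral_add (f := fun z : ℝ × ℝ => f (X z.1 - X z.2) + f (Y z.1 - Y z.2))
        (i1.add i2) i3]
    refine integral_mono_ae ((integrable_interaction hf _).const_mul 2) ((i1.add i2).add i3) ?_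
    filter_upwards [ae_prod_of_ae (Lp.coeFn_sub X Y), ae_prod_of_ae (Lp.coeFn_add X Y),
      ae_prod_of_ae (Lp.coeFn_smul (1 / 2 : ℝ) (X + Y))] with z h1 h2 h3
    simp only [h3.1, h3.2, Pi.smul_apply, h2.1, h2.2, Pi.add_apply, h1.1, h1.2, Pi.sub_apply]
    have h := hmid (X z.1 - X z.2) (Y z.1 - Y z.2)
    have e1 : (1 / 2 : ℝ) • (X z.1 - X z.2 + (Y z.1 - Y z.2))
        = (1 / 2 : ℝ) • (X z.1 + Y z.1) - (1 / 2 : ℝ) • (X z.2 + Y z.2) := by module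
    have e2 : X z.1 - X z.2 - (Y z.1 - Y z.2) = (X z.1 - Y z.1) - (X z.2 - Y z.2) := by abel
    rw [e1, e2] at h
    have h4 : ‖(X z.1 - Y z.1) - (X z.2 - Y z.2)‖ ^ 2
        ≤ 2 * (‖X z.1 - Y z.1‖ ^ 2 + ‖X z.2 - Y z.2‖ ^ 2) := by
      have := parallelogram_law_with_norm ℝ (X z.1 - Y z.1) (X z.2 - Y z.2)
      nlinarith [norm_nonneg ((X z.1 - Y z.1) + (X z.2 - Y z.2))]
    have h5 := mul_le_mul_of_nonneg_left h4 (by linarith : (0 : ℝ) ≤ k / 4)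
    linarith
  rw [integral_norm_sq_eq_norm_sq] at hle
  simp only [interaction_eq_integral_prod hf]
  linarith

namespace IsInteraction

variable {f : E d → ℝ} {c : ℝ}

theorem exists_lipschitzWith (hf : IsInteraction f c) : ∃ C : NNReal, LipschitzWith C f := by
  obtain ⟨C, hC⟩ := hf.bounded_derivs 1 (by simp)
  refine ⟨C.toNNReal, lipschitzWith_of_nnnorm_fderiv_le
    (hf.contDiff.differentiable (by norm_num)) fun x => ?_⟩
  rw [← NNReal.coe_le_coe, coe_nnnorm, ← norm_iteratedFDeriv_one]
  exact (hC x).trans (Real.le_coe_toNNReal C)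

theorem midpoint_le (hf : IsInteraction f c) (x y : E d) :
    2 * f ((1 / 2 : ℝ) • (x + y)) ≤ f x + f y + max (-c) 0 / 4 * ‖x - y‖ ^ 2 := by
  have hline : ∀ s : ℝ, HasDerivAt (fun s : ℝ => x + s • (y - x)) (y - x) s := fun s => by
    simpa using ((hasDerivAt_id s).smul_const (y - x)).const_add x
  have hd1 : Differentiable ℝ f := hf.contDiff.differentiable (by norm_num)
  have hd2 : Differentiable ℝ (fderiv ℝ f) :=
    (hf.contDiff.fderiv_right (m := 2) (by norm_num)).differentiable (by norm_num)
  have h1 : deriv (fun s : ℝ => f (x + s • (y - x)))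
      = fun s : ℝ => fderiv ℝ f (x + s • (y - x)) (y - x) := funext fun s =>
    ((hd1 _).hasFDerivAt.comp_hasDerivAt s (hline s)).deriv
  have h2 : ∀ s : ℝ, iteratedDeriv 2 (fun s : ℝ => f (x + s • (y - x))) s
      = hess f (x + s • (y - x)) (y - x) (y - x) := by
    intro s
    rw [iteratedDeriv_succ, iteratedDeriv_one, h1]
    have h3 : HasDerivAt (fun s : ℝ => fderiv ℝ f (x + s • (y - x)))
        (hess f (x + s • (y - x)) (y - x)) s :=
      (hd2 _).hasFDerivAt.comp_hasDerivAt s (hline s)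
    exact ((h3.clm_apply (hasDerivAt_const s (y - x))).congr_deriv (by simp)).deriv
  have hg : ContDiff ℝ 2 (fun s : ℝ => f (x + s • (y - x))) :=
    (hf.contDiff.of_le (by norm_num)).comp (by fun_prop)
  have h := midpoint_add_le_of_le_iteratedDeriv_two hg (c := c * ‖y - x‖ ^ 2)
    fun s _ => by rw [h2]; exact hf.hess_ge _ _
  have e : x + (1 / 2 : ℝ) • (y - x) = (1 / 2 : ℝ) • (x + y) := by module
  rw [e, zero_smul, one_smul, add_zero, add_sub_cancel, norm_sub_rev] at h
  nlinarith [mul_le_mul_of_nonneg_right (le_max_left (-c) 0) (sq_nonneg ‖x - y‖)]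

end IsInteraction

/-! ### Curves parametrised by their velocity -/

/-- The Hilbert space `L²(0,T;ℍ)` of velocity fields. -/
abbrev VelocitySpace (d : ℕ) (T : ℝ) : Type := Lp (HS d) 2 (volume.restrict (Ioo (0 : ℝ) T))

/-- The curve with velocity `V` that ends at `X` at time `T`. -/
noncomputable def endpointCurve (T : ℝ) (X : HS d) (V : VelocitySpace d T) (t : ℝ) : HS d :=
  X + ∫ s in T..t, V s

section Curve

variable {T : ℝ} (hT : 0 < T) (X : HS d)

theorem endpointCurve_self (V : VelocitySpace d T) : endpointCurve T X V T = X := by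
  simp [endpointCurve]

theorem integrableOn_velocity (V : VelocitySpace d T) : IntegrableOn V (Ioo 0 T) :=
  (Lp.memLp V).integrable one_le_two

include hT in
theorem intervalIntegrable_velocity (V : VelocitySpace d T) : IntervalIntegrable V volume 0 T :=
  (intervalIntegrable_iff_integrableOn_Ioo_of_le hT.le).2 (integrableOn_velocity V)

include hT in
theorem intervalIntegrable_velocity_of_mem (V : VelocitySpace d T) {t : ℝ} (ht : t ∈ Icc 0 T) :
    IntervalIntegrable V volume T t := by
  rw [← uIcc_of_le hT.le] at ht
  exact (intervalIntegrable_velocity hT V).mono_set (uIcc_subset_uIcc right_mem_uIcc ht)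

include hT in
theorem ae_of_ae_restrict_Ioo {p : ℝ → Prop} (h : ∀ᵐ t ∂(volume.restrict (Ioo 0 T)), p t) :
    ∀ᵐ t, t ∈ uIcc 0 T → p t := by
  rw [Measure.restrict_congr_set Ioo_ae_eq_Icc, ae_restrict_iff' measurableSet_Icc] at h
  rwa [uIcc_of_le hT.le]

include hT in
theorem intervalIntegral_congr_velocity {f g : ℝ → HS d}
    (h : f =ᵐ[volume.restrict (Ioo 0 T)] g) {t : ℝ} (ht : t ∈ Icc 0 T) :
    ∫ s in T..t, f s = ∫ s in T..t, g s := by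
  refine intervalIntegral.integral_congr_ae ?_
  filter_upwards [ae_of_ae_restrict_Ioo hT h] with s hs hst
  refine hs (uIcc_subset_uIcc right_mem_uIcc ?_ (uIoc_subset_uIcc hst))
  rwa [uIcc_of_le hT.le]

include hT in
/-- Two curves with a common endpoint differ by at most the `L¹` distance of their velocities,
to which the Cauchy–Schwarz inequality applies. -/
theorem norm_endpointCurve_sub_sq_le (U V : VelocitySpace d T) {t : ℝ} (ht : t ∈ Icc 0 T) :
    ‖endpointCurve T X U t - endpointCurve T X V t‖ ^ 2 ≤ T * ‖U - V‖ ^ 2 := by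
  have e : endpointCurve T X U t - endpointCurve T X V t = ∫ s in T..t, (U - V) s := by
    rw [intervalIntegral_congr_velocity hT (Lp.coeFn_sub U V) ht]
    simp only [Pi.sub_apply]
    rw [intervalIntegral.integral_sub (intervalIntegrable_velocity_of_mem hT U ht)
      (intervalIntegrable_velocity_of_mem hT V ht), endpointCurve, endpointCurve]
    abel
  have h1 : ‖∫ s in T..t, (U - V) s‖ ≤ ∫ s in Ioo 0 T, ‖(U - V) s‖ := by
    refine intervalIntegral.norm_integral_le_integral_norm_uIoc.trans ?_
    rw [← integral_Ioc_eq_integral_Ioo]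
    refine setIntegral_mono_set ?_ (Eventually.of_forall fun s => norm_nonneg _) ?_
    · exact (integrableOn_Ioc_iff_integrableOn_Ioo).2 (integrableOn_velocity _).norm
    · rw [uIoc_of_ge ht.2]
      exact (Ioc_subset_Ioc_left ht.1).eventuallyLE
  have h2 := sq_integral_norm_le (U - V)
  have e3 : (volume.restrict (Ioo 0 T)).real univ = T := by simp [hT.le]
  rw [e3] at h2
  rw [e]
  exact (pow_le_pow_left₀ (norm_nonneg _) h1 2).trans h2

include hT in
theorem dist_endpointCurve_le (U V : VelocitySpace d T) {t : ℝ} (ht : t ∈ Icc 0 T) :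
    dist (endpointCurve T X U t) (endpointCurve T X V t) ≤ √T * dist U V := by
  rw [dist_eq_norm, dist_eq_norm]
  refine le_of_sq_le_sq ((norm_endpointCurve_sub_sq_le hT X U V ht).trans_eq ?_) (by positivity)
  rw [mul_pow, Real.sq_sqrt hT.le]

include hT in
theorem continuous_endpointCurve_velocity {t : ℝ} (ht : t ∈ Icc 0 T) :
    Continuous fun V : VelocitySpace d T => endpointCurve T X V t :=
  (LipschitzWith.of_dist_le_mul (K := (√T).toNNReal) fun U V => by
    rw [Real.coe_toNNReal _ (Real.sqrt_nonneg T)]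
    exact dist_endpointCurve_le hT X U V ht).continuous

include hT in
theorem endpointCurve_midpoint (U V : VelocitySpace d T) {t : ℝ} (ht : t ∈ Icc 0 T) :
    endpointCurve T X ((1 / 2 : ℝ) • (U + V)) t
      = (1 / 2 : ℝ) • (endpointCurve T X U t + endpointCurve T X V t) := by
  have h : ((1 / 2 : ℝ) • (U + V) : VelocitySpace d T)
      =ᵐ[volume.restrict (Ioo 0 T)] fun s => (1 / 2 : ℝ) • (U s + V s) := by
    filter_upwards [Lp.coeFn_smul (1 / 2 : ℝ) (U + V), Lp.coeFn_add U V] with s h1 h2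
    simp only [h1, h2, Pi.smul_apply, Pi.add_apply]
  rw [endpointCurve, intervalIntegral_congr_velocity hT h ht, intervalIntegral.integral_smul,
    intervalIntegral.integral_add (intervalIntegrable_velocity_of_mem hT U ht)
      (intervalIntegrable_velocity_of_mem hT V ht), endpointCurve, endpointCurve]
  module

include hT in
theorem endpointCurve_zero {t : ℝ} (ht : t ∈ Icc 0 T) :
    endpointCurve T X (0 : VelocitySpace d T) t = X := by
  rw [endpointCurve, intervalIntegral_congr_velocity hT (Lp.coeFn_zero _ _ _) ht]
  simp

include hT in
theorem absolutelyContinuousOnInterval_endpointCurve (V : VelocitySpace d T) :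
    AbsolutelyContinuousOnInterval (endpointCurve T X V) 0 T :=
  absolutelyContinuousOnInterval_of_dist_le
    (absolutelyContinuousOnInterval_integral (intervalIntegrable_velocity hT V) right_mem_uIcc)
    fun x _ y _ => by simp only [endpointCurve, dist_add_left]; exact le_rfl

include hT in
theorem continuousOn_endpointCurve (V : VelocitySpace d T) :
    ContinuousOn (endpointCurve T X V) (Icc 0 T) := by
  have h := (absolutelyContinuousOnInterval_endpointCurve hT X V).continuousOn
  rwa [uIcc_of_le hT.le] at h

include hT in
theorem ae_hasDerivAt_endpointCurve (V : VelocitySpace d T) :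
    ∀ᵐ t ∂(volume.restrict (Ioo 0 T)), HasDerivAt (endpointCurve T X V) (V t) t := by
  rw [ae_restrict_iff' measurableSet_Ioo]
  filter_upwards [(intervalIntegrable_velocity hT V).ae_hasDerivAt_integral] with t h ht
  refine HasDerivAt.const_add X (h ?_ T right_mem_uIcc)
  rw [uIcc_of_le hT.le]
  exact Ioo_subset_Icc_self ht

include hT in
theorem deriv_endpointCurve_ae_eq (V : VelocitySpace d T) :
    deriv (endpointCurve T X V) =ᵐ[volume.restrict (Ioo 0 T)] V :=
  (ae_hasDerivAt_endpointCurve hT X V).mono fun _ h => h.deriv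

include hT in
theorem endpointCurve_mem_AC2 (V : VelocitySpace d T) : endpointCurve T X V ∈ AC2 T :=
  ⟨absolutelyContinuousOnInterval_endpointCurve hT X V,
    (ae_hasDerivAt_endpointCurve hT X V).mono fun _ h => h.differentiableAt,
    (memLp_congr_ae (deriv_endpointCurve_ae_eq hT X V)).2 (Lp.memLp V)⟩

include hT in
/-- Every curve in `AC2 T` that ends at `X` is, on `[0,T]`, the endpoint curve of its derivative. -/
theorem exists_velocity_of_mem_AC2 {η : ℝ → HS d} (hη : η ∈ AC2 T) (hηT : η T = X) :
    ∃ V : VelocitySpace d T, deriv η =ᵐ[volume.restrict (Ioo 0 T)] V ∧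
      EqOn η (endpointCurve T X V) (Icc 0 T) := by
  obtain ⟨hac, hdiff, hmem⟩ := hη
  have hV := hmem.coeFn_toLp
  refine ⟨hmem.toLp _, hV.symm, fun t ht => ?_⟩
  have h := sub_eq_integral_of_ae_hasDerivAt hac
    (intervalIntegrable_velocity hT (hmem.toLp _)) (f' := hmem.toLp _) (x := t)
    (ae_of_ae_restrict_Ioo hT (by
      filter_upwards [hdiff, hV] with s h1 h2
      rw [h2]; exact h1.hasDerivAt)) (by rwa [uIcc_of_le hT.le])
  rw [endpointCurve, ← h, hηT]
  abel

end Curve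

/-! ### The cost as a functional of the velocity -/

/-- The Lagrangian part of the action, as a functional of the velocity. -/
noncomputable def lagrangianAction (L : E d × E d → ℝ) (T : ℝ) (X : HS d)
    (V : VelocitySpace d T) : ℝ≥0∞ :=
  ∫⁻ t in Ioo 0 T, lagrangianCost L (endpointCurve T X V t, V t)

/-- The interaction part of the total cost, as a functional of the velocity. -/
noncomputable def interactionAction (Φ Ψ : E d → ℝ) (T : ℝ) (X : HS d)
    (V : VelocitySpace d T) : ℝ :=
  (∫ t in Ioo 0 T, interaction Φ (endpointCurve T X V t)) + interaction Ψ (endpointCurve T X V 0)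

section Cost

variable {T : ℝ} (hT : 0 < T) (X : HS d) {L : E d × E d → ℝ} {Φ Ψ : E d → ℝ}

include hT in
theorem aemeasurable_lagrangianCost_endpointCurve (hL : Continuous L) (V : VelocitySpace d T) :
    AEMeasurable (fun t => lagrangianCost L (endpointCurve T X V t, V t))
      (volume.restrict (Ioo 0 T)) :=
  aemeasurable_comp_of_lowerSemicontinuous (lowerSemicontinuous_lagrangianCost hL)
    ((((continuousOn_endpointCurve hT X V).mono Ioo_subset_Icc_self).aestronglyMeasurable
      measurableSet_Ioo).prodMk (Lp.aestronglyMeasurable V))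

include hT in
theorem integrable_interaction_endpointCurve {C : NNReal} (hΦ : LipschitzWith C Φ)
    (V : VelocitySpace d T) :
    Integrable (fun t => interaction Φ (endpointCurve T X V t)) (volume.restrict (Ioo 0 T)) :=
  (((continuous_interaction hΦ).comp_continuousOn
    (continuousOn_endpointCurve hT X V)).integrableOn_Icc).mono_set Ioo_subset_Icc_self

include hT in
/-- The cost of a curve in terms of its velocity. The values of the curve outside `[0,T]` and of the
velocity on a null set play no role. -/
theorem totalCost_eq (hL : Continuous L) (hL₀ : ∀ z, 0 ≤ L z) {C : NNReal}
    (hΦ : LipschitzWith C Φ) {η : ℝ → HS d} {V : VelocitySpace d T}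
    (hd : deriv η =ᵐ[volume.restrict (Ioo 0 T)] V)
    (hη : EqOn η (endpointCurve T X V) (Icc 0 T)) :
    totalCost L Φ Ψ T η
      = (lagrangianAction L T X V : EReal) + (interactionAction Φ Ψ T X V : ℝ) := by
  have e : (fun t => runningCost L Φ (η t) (deriv η t)) =ᵐ[volume.restrict (Ioo 0 T)]
      fun t => (lagrangianCost L (endpointCurve T X V t, V t) : EReal)
        + (interaction Φ (endpointCurve T X V t) : ℝ) := by
    filter_upwards [hd, ae_restrict_mem measurableSet_Ioo] with t h1 h2
    rw [runningCost_eq hL₀, h1, hη (Ioo_subset_Icc_self h2)]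
  rw [totalCost, action, extIntegral_congr_ae e,
    extIntegral_coe_add (aemeasurable_lagrangianCost_endpointCurve hT X hL V)
      (integrable_interaction_endpointCurve hT X hΦ V), hη (left_mem_Icc.2 hT.le),
    interactionAction, EReal.coe_add, lagrangianAction, add_assoc]

include hT in
theorem lowerSemicontinuous_lagrangianAction (hL : Continuous L) :
    LowerSemicontinuous (lagrangianAction L T X) := by
  refine lowerSemicontinuous_lintegral_comp
    (F := fun (V : VelocitySpace d T) t => (endpointCurve T X V t, V t))
    (lowerSemicontinuous_lagrangianCost hL)
    (fun V => aemeasurable_lagrangianCost_endpointCurve hT X hL V) fun u v huv => ?_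
  obtain ⟨ns, hns, h⟩ := exists_subseq_ae_tendsto_of_tendsto_Lp huv
  refine ⟨ns, hns, ?_⟩
  filter_upwards [h, ae_restrict_mem measurableSet_Ioo] with t h1 h2
  exact ((((continuous_endpointCurve_velocity hT X (Ioo_subset_Icc_self h2)).tendsto v).comp
    huv).comp hns.tendsto_atTop).prodMk_nhds h1

include hT in
theorem lagrangianAction_midpoint_add_le {c₀ c₁ lam₀ : ℝ} (hL : IsLagrangian L c₀ c₁ lam₀)
    (U V : VelocitySpace d T) :
    2 * lagrangianAction L T X ((1 / 2 : ℝ) • (U + V))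
        + ENNReal.ofReal (lam₀ / 4 * ‖U - V‖ ^ 2)
      ≤ lagrangianAction L T X U + lagrangianAction L T X V := by
  have hc := hL.contDiff.continuous
  refine lintegral_midpoint_add_le (by linarith [hL.lam₀_pos]) U V
    (aemeasurable_lagrangianCost_endpointCurve hT X hc _)
    (aemeasurable_lagrangianCost_endpointCurve hT X hc _) ?_
  filter_upwards [Lp.coeFn_smul (1 / 2 : ℝ) (U + V), Lp.coeFn_add U V,
    ae_restrict_mem measurableSet_Ioo] with t h1 h2 h3
  rw [h1, Pi.smul_apply, h2, Pi.add_apply,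
    endpointCurve_midpoint hT X U V (Ioo_subset_Icc_self h3)]
  exact hL.lagrangianCost_midpoint_add_le _ _ _ _

include hT in
theorem lagrangianAction_zero_lt_top {c₀ c₁ lam₀ : ℝ} (hL : IsLagrangian L c₀ c₁ lam₀) :
    lagrangianAction L T X 0 < ⊤ := by
  have e : lagrangianAction L T X 0 = ∫⁻ _t in Ioo 0 T, lagrangianCost L (X, 0) := by
    refine lintegral_congr_ae ?_
    filter_upwards [Lp.coeFn_zero (HS d) 2 (volume.restrict (Ioo (0 : ℝ) T)),
      ae_restrict_mem measurableSet_Ioo] with t h1 h2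
    rw [h1, Pi.zero_apply, endpointCurve_zero hT X (Ioo_subset_Icc_self h2)]
  rw [e, lintegral_const]
  exact ENNReal.mul_lt_top (hL.lagrangianCost_zero_lt_top X) (measure_lt_top _ _)

include hT in
theorem continuous_interactionAction {C C' : NNReal} (hΦ : LipschitzWith C Φ)
    (hΨ : LipschitzWith C' Ψ) : Continuous (interactionAction Φ Ψ T X) := by
  have hb : ∀ {f : E d → ℝ} {K : NNReal}, LipschitzWith K f → ∀ U V : VelocitySpace d T,
      ∀ t ∈ Icc 0 T, |interaction f (endpointCurve T X U t)
        - interaction f (endpointCurve T X V t)| ≤ K * (√T * dist U V) := by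
    intro f K hf U V t ht
    refine (abs_interaction_sub_le hf _ _).trans ?_
    rw [← dist_eq_norm]
    exact mul_le_mul_of_nonneg_left (dist_endpointCurve_le hT X U V ht) K.2
  refine Continuous.add (LipschitzWith.of_dist_le_mul (K := (C * √T * T).toNNReal)
    fun U V => ?_).continuous
    ((continuous_interaction hΨ).comp
      (continuous_endpointCurve_velocity hT X (left_mem_Icc.2 hT.le)))
  rw [Real.coe_toNNReal _ (by positivity), Real.dist_eq, ← integral_sub
    (integrable_interaction_endpointCurve hT X hΦ U)
    (integrable_interaction_endpointCurve hT X hΦ V), ← Real.norm_eq_abs]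
  have h := norm_setIntegral_le_of_norm_le_const (μ := volume) (s := Ioo 0 T)
    (f := fun t => interaction Φ (endpointCurve T X U t) - interaction Φ (endpointCurve T X V t))
    (by simp)
    (fun t ht => hb hΦ U V t (Ioo_subset_Icc_self ht))
  refine h.trans_eq ?_
  rw [Real.volume_real_Ioo_of_le hT.le]
  ring

include hT in
theorem interactionAction_midpoint_le {C C' : NNReal} (hΦ : LipschitzWith C Φ)
    (hΨ : LipschitzWith C' Ψ) {k k' : ℝ} (hk : 0 ≤ k) (hk' : 0 ≤ k')
    (hmid : ∀ x y : E d, 2 * Φ ((1 / 2 : ℝ) • (x + y)) ≤ Φ x + Φ y + k / 4 * ‖x - y‖ ^ 2)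
    (hmid' : ∀ x y : E d, 2 * Ψ ((1 / 2 : ℝ) • (x + y)) ≤ Ψ x + Ψ y + k' / 4 * ‖x - y‖ ^ 2)
    (U V : VelocitySpace d T) :
    2 * interactionAction Φ Ψ T X ((1 / 2 : ℝ) • (U + V))
      ≤ interactionAction Φ Ψ T X U + interactionAction Φ Ψ T X V
        + (T ^ 2 * k + T * k') / 2 * ‖U - V‖ ^ 2 := by
  have hpt : ∀ {f : E d → ℝ} {K : NNReal} {k : ℝ}, LipschitzWith K f → 0 ≤ k →
      (∀ x y : E d, 2 * f ((1 / 2 : ℝ) • (x + y)) ≤ f x + f y + k / 4 * ‖x - y‖ ^ 2) →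
      ∀ t ∈ Icc 0 T, 2 * interaction f (endpointCurve T X ((1 / 2 : ℝ) • (U + V)) t)
        ≤ interaction f (endpointCurve T X U t) + interaction f (endpointCurve T X V t)
          + k / 2 * (T * ‖U - V‖ ^ 2) := by
    intro f K k hf hk hm t ht
    rw [endpointCurve_midpoint hT X U V ht]
    refine (interaction_midpoint_le hf hk hm _ _).trans ?_
    have := mul_le_mul_of_nonneg_left (norm_endpointCurve_sub_sq_le hT X U V ht)
      (by linarith : 0 ≤ k / 2)
    linarith
  have iU := integrable_interaction_endpointCurve hT X hΦ U
  have iV := integrable_interaction_endpointCurve hT X hΦ V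
  have h1 : 2 * ∫ t in Ioo 0 T, interaction Φ (endpointCurve T X ((1 / 2 : ℝ) • (U + V)) t)
      ≤ (∫ t in Ioo 0 T, interaction Φ (endpointCurve T X U t))
        + (∫ t in Ioo 0 T, interaction Φ (endpointCurve T X V t))
        + T * (k / 2 * (T * ‖U - V‖ ^ 2)) := by
    have e : T * (k / 2 * (T * ‖U - V‖ ^ 2))
        = ∫ _t in Ioo 0 T, k / 2 * (T * ‖U - V‖ ^ 2) := by
      rw [setIntegral_const, Real.volume_real_Ioo_of_le hT.le, sub_zero, smul_eq_mul]
    rw [e, ← integral_const_mul, ← integral_add iU iV,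
      ← integral_add (f := fun t => interaction Φ (endpointCurve T X U t)
        + interaction Φ (endpointCurve T X V t)) (iU.add iV) (integrable_const _)]
    refine integral_mono_ae ((integrable_interaction_endpointCurve hT X hΦ _).const_mul 2)
      ((iU.add iV).add (integrable_const _)) ?_
    filter_upwards [ae_restrict_mem measurableSet_Ioo] with t ht
    exact hpt hΦ hk hmid t (Ioo_subset_Icc_self ht)
  have h2 := hpt hΨ hk' hmid' 0 (left_mem_Icc.2 hT.le)
  simp only [interactionAction]
  linarith

include hT in
theorem le_interactionAction {C C' : NNReal} (hΦ : LipschitzWith C Φ) (hΨ : LipschitzWith C' Ψ)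
    {m m' : ℝ} (hm : ∀ x, m ≤ Φ x) (hm' : ∀ x, m' ≤ Ψ x) (V : VelocitySpace d T) :
    T * (m / 2) + m' / 2 ≤ interactionAction Φ Ψ T X V := by
  refine add_le_add ?_ (le_interaction hΨ hm' _)
  have e : T * (m / 2) = ∫ _t in Ioo 0 T, m / 2 := by
    rw [setIntegral_const, Real.volume_real_Ioo_of_le hT.le, sub_zero, smul_eq_mul]
  rw [e]
  exact integral_mono (integrable_const _) (integrable_interaction_endpointCurve hT X hΦ V)
    fun t => le_interaction hΦ hm _

include hT in
/-- The total cost, written as a functional of the velocity, has exactly one minimiser. -/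
theorem exists_unique_minimal_velocity {c₀ c₁ lam₀ cΦ cΨ : ℝ} (hL : IsLagrangian L c₀ c₁ lam₀)
    (hΦ : IsInteraction Φ cΦ) (hΨ : IsInteraction Ψ cΨ)
    (hsmall : T ^ 2 * max (-cΦ) 0 + T * max (-cΨ) 0 < lam₀ / 2) :
    ∃ V : VelocitySpace d T, lagrangianAction L T X V ≠ ⊤ ∧
      (∀ U, (lagrangianAction L T X V : EReal) + (interactionAction Φ Ψ T X V : ℝ)
        ≤ (lagrangianAction L T X U : EReal) + (interactionAction Φ Ψ T X U : ℝ)) ∧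
      ∀ U, (lagrangianAction L T X U : EReal) + (interactionAction Φ Ψ T X U : ℝ)
        ≤ (lagrangianAction L T X V : EReal) + (interactionAction Φ Ψ T X V : ℝ) → U = V := by
  obtain ⟨C, hC⟩ := hΦ.exists_lipschitzWith
  obtain ⟨C', hC'⟩ := hΨ.exists_lipschitzWith
  obtain ⟨m, hm⟩ := hΦ.bounded_below
  obtain ⟨m', hm'⟩ := hΨ.bounded_below
  -- Adding the constant `K` makes the interaction part nonnegative, so that the functional takes
  -- values in `[0, ∞]`.
  set K : ℝ := -(T * (m / 2) + m' / 2) with hK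
  have hR0 : ∀ V, 0 ≤ interactionAction Φ Ψ T X V + K := fun V => by
    linarith [le_interactionAction hT X hC hC' hm hm' V]
  let G : VelocitySpace d T → ℝ≥0∞ := fun V =>
    lagrangianAction L T X V + ENNReal.ofReal (interactionAction Φ Ψ T X V + K)
  have hlsc : LowerSemicontinuous G :=
    (lowerSemicontinuous_lagrangianAction hT X hL.contDiff.continuous).add
      (ENNReal.continuous_ofReal.comp
        ((continuous_interactionAction hT X hC hC').add continuous_const)).lowerSemicontinuous
  have hG0 : G 0 ≠ ⊤ :=
    ENNReal.add_ne_top.2 ⟨(lagrangianAction_zero_lt_top hT X hL).ne, ENNReal.ofReal_ne_top⟩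
  set κ : ℝ := (T ^ 2 * max (-cΦ) 0 + T * max (-cΨ) 0) / 2 with hκ
  have hc : 0 < lam₀ / 4 - κ := by rw [hκ]; linarith
  have hconv : ∀ U V, 2 * G ((1 / 2 : ℝ) • (U + V))
      + ENNReal.ofReal ((lam₀ / 4 - κ) * ‖U - V‖ ^ 2) ≤ G U + G V := by
    intro U V
    have h1 := lagrangianAction_midpoint_add_le hT X hL U V
    have h2 := interactionAction_midpoint_le hT X hC hC' (le_max_right (-cΦ) 0)
      (le_max_right (-cΨ) 0) hΦ.midpoint_le hΨ.midpoint_le U V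
    rw [← hκ] at h2
    have h3 : 2 * ENNReal.ofReal (interactionAction Φ Ψ T X ((1 / 2 : ℝ) • (U + V)) + K)
        + ENNReal.ofReal ((lam₀ / 4 - κ) * ‖U - V‖ ^ 2)
        ≤ ENNReal.ofReal (lam₀ / 4 * ‖U - V‖ ^ 2)
          + (ENNReal.ofReal (interactionAction Φ Ψ T X U + K)
            + ENNReal.ofReal (interactionAction Φ Ψ T X V + K)) := by
      have hl := hL.lam₀_pos
      rw [two_mul, ← ENNReal.ofReal_add (hR0 _) (hR0 _),
        ← ENNReal.ofReal_add (add_nonneg (hR0 _) (hR0 _)) (by positivity),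
        ← ENNReal.ofReal_add (hR0 _) (hR0 _),
        ← ENNReal.ofReal_add (by positivity) (add_nonneg (hR0 _) (hR0 _))]
      exact ENNReal.ofReal_le_ofReal (by linarith)
    calc 2 * G ((1 / 2 : ℝ) • (U + V)) + ENNReal.ofReal ((lam₀ / 4 - κ) * ‖U - V‖ ^ 2)
        = 2 * lagrangianAction L T X ((1 / 2 : ℝ) • (U + V))
          + (2 * ENNReal.ofReal (interactionAction Φ Ψ T X ((1 / 2 : ℝ) • (U + V)) + K)
            + ENNReal.ofReal ((lam₀ / 4 - κ) * ‖U - V‖ ^ 2)) := by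
          simp only [G]; ring
      _ ≤ 2 * lagrangianAction L T X ((1 / 2 : ℝ) • (U + V))
          + (ENNReal.ofReal (lam₀ / 4 * ‖U - V‖ ^ 2)
          + (ENNReal.ofReal (interactionAction Φ Ψ T X U + K)
            + ENNReal.ofReal (interactionAction Φ Ψ T X V + K))) := by gcongr
      _ ≤ lagrangianAction L T X U + lagrangianAction L T X V
          + (ENNReal.ofReal (interactionAction Φ Ψ T X U + K)
            + ENNReal.ofReal (interactionAction Φ Ψ T X V + K)) := by
          rw [← add_assoc]; gcongr
      _ = G U + G V := by simp only [G]; ring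
  obtain ⟨V, hmin, huniq⟩ := exists_unique_forall_le_of_midpoint hlsc hG0 hc hconv
  have hGF : ∀ U, (G U : EReal)
      = (lagrangianAction L T X U : EReal) + (interactionAction Φ Ψ T X U : ℝ) + (K : ℝ) := by
    intro U
    simp only [G]
    rw [EReal.coe_ennreal_add, EReal.coe_ennreal_ofReal, max_eq_left (hR0 U), EReal.coe_add,
      add_assoc]
  have hFG : ∀ U, (lagrangianAction L T X U : EReal) + (interactionAction Φ Ψ T X U : ℝ)
      = (G U : EReal) + ((-K : ℝ) : EReal) := by
    intro U
    rw [hGF, add_assoc _ (K : EReal), ← EReal.coe_add, add_neg_cancel, EReal.coe_zero, add_zero]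
  have hVtop : G V ≠ ⊤ := ne_top_of_le_ne_top hG0 (hmin 0)
  refine ⟨V, (ENNReal.add_ne_top.1 hVtop).1, fun U => ?_, fun U hU => huniq U ?_⟩
  · rw [hFG, hFG]
    exact add_le_add_left (EReal.coe_ennreal_le_coe_ennreal_iff.2 (hmin U)) _
  · rw [← EReal.coe_ennreal_le_coe_ennreal_iff, hGF, hGF]
    exact add_le_add_left hU _

end Cost

end MFG

theorem mainTheorem2 {d : ℕ} (L : MFG.E d × MFG.E d → ℝ) (Φ Ψ : MFG.E d → ℝ)
    (c₀ c₁ lam₀ cΦ cΨ : ℝ)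
    (hL : MFG.IsLagrangian L c₀ c₁ lam₀)
    (hΦ : MFG.IsInteraction Φ cΦ) (hΨ : MFG.IsInteraction Ψ cΨ)
    (T : ℝ) (hT : 0 < T)
    (hsmall : T ^ 2 * (max (-cΦ) 0 + 2 * MFG.hessSup Φ)
      + T * (max (-cΨ) 0 + 2 * MFG.hessSup Ψ) < lam₀ / 2)
    (X : MFG.HS d) :
    (∃ u : ℝ, MFG.value L Φ Ψ T X = (u : EReal)) ∧
    ∃ γ : ℝ → MFG.HS d,
      (γ ∈ MFG.AC2 T ∧ γ T = X ∧ MFG.totalCost L Φ Ψ T γ = MFG.value L Φ Ψ T X) ∧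
      ∀ η : ℝ → MFG.HS d,
        (η ∈ MFG.AC2 T ∧ η T = X ∧ MFG.totalCost L Φ Ψ T η = MFG.value L Φ Ψ T X) →
        Set.EqOn η γ (Set.Icc 0 T) := by
  -- The Hessian terms in the smallness condition are nonnegative and can be dropped.
  have hsup : ∀ f : MFG.E d → ℝ, 0 ≤ MFG.hessSup f := fun f =>
    Real.iSup_nonneg fun x => norm_nonneg (MFG.hess f x)
  obtain ⟨V, hVtop, hmin, huniq⟩ := MFG.exists_unique_minimal_velocity hT X hL hΦ hΨ (by
    nlinarith [mul_nonneg (sq_nonneg T) (hsup Φ), mul_nonneg hT.le (hsup Ψ)])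
  obtain ⟨C, hC⟩ := hΦ.exists_lipschitzWith
  have hcost := fun (η : ℝ → MFG.HS d) (U : MFG.VelocitySpace d T) =>
    MFG.totalCost_eq (Ψ := Ψ) hT X hL.contDiff.continuous hL.nonneg hC (η := η) (V := U)
  have hcostV := hcost _ V (MFG.deriv_endpointCurve_ae_eq hT X V) (fun _ _ => rfl)
  have hvalue : MFG.value L Φ Ψ T X
      = (MFG.lagrangianAction L T X V : EReal) + (MFG.interactionAction Φ Ψ T X V : ℝ) := by
    refine IsGLB.sInf_eq (IsLeast.isGLB ⟨⟨MFG.endpointCurve T X V,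
      ⟨MFG.endpointCurve_mem_AC2 hT X V, MFG.endpointCurve_self X V⟩, hcostV⟩, ?_⟩)
    rintro _ ⟨η, ⟨hη, hηT⟩, rfl⟩
    obtain ⟨U, hU, hηU⟩ := MFG.exists_velocity_of_mem_AC2 hT X hη hηT
    rw [hcost η U hU hηU]
    exact hmin U
  refine ⟨?_, MFG.endpointCurve T X V, ⟨MFG.endpointCurve_mem_AC2 hT X V,
    MFG.endpointCurve_self X V, hcostV.trans hvalue.symm⟩, ?_⟩
  · refine ⟨(MFG.lagrangianAction L T X V).toReal + MFG.interactionAction Φ Ψ T X V, ?_⟩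
    rw [hvalue, EReal.coe_add, EReal.coe_ennreal_toReal hVtop]
  · rintro η ⟨hη, hηT, hηmin⟩
    obtain ⟨U, hU, hηU⟩ := MFG.exists_velocity_of_mem_AC2 hT X hη hηT
    rw [hcost η U hU hηU, hvalue] at hηmin
    rwa [huniq U hηmin.le] at hηU
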